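/- For real $\lambda$ let $$J_\lambda(x)=\sum_{k=0}^\infty \frac{(-1)^k}{k!\,\Gamma(\lambda+k+1)}\Big(\frac{x}{2}\Big)^{2k+\lambda},\qquad x>0,$$ be the Bessel function of the first kind of order $\lambda$. Let $\nu>0$ and $m\in\{0,1\}$. Then $J_\nu'$ and $J_{\nu+m}$ each have infinitely many positive zeros, which can be arranged in strictly ascending sequences $\{j'_{\nu,k}\}_{k\ge1}$ (all positive zeros of $J_\nu'$) and $\{j_{\nu+m,k}\}_{k\ge1}$ (all positive zeros of $J_{\nu+m}$), and these sequences interlace according to the pattern $$0<j'_{\nu,1}<j_{\nu+m,1}<j'_{\nu,2}<j_{\nu+m,2}<\cdots .$$ -/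

import Mathlib

/-- The Bessel function of the first kind of real order `ν`,
`J_ν(x) = ∑_{k ≥ 0} (-1)^k / (k! Γ(ν + k + 1)) (x / 2)^(2k + ν)`, for `x > 0`
(only positive arguments are used). The values `Γ(-n) = 0` and `1 / 0 = 0` agree with the
convention `1 / Γ(-n) = 0`. -/
noncomputable def besselJ (ν x : ℝ) : ℝ :=
  ∑' k : ℕ, (-1) ^ k / (Nat.factorial k * Real.Gamma (ν + k + 1)) * (x / 2) ^ (2 * (k : ℝ) + ν)

/-- `a 0 < a 1 < a 2 < ⋯` is the sequence of all positive zeros of `f` in ascending order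
(the zero usually numbered `k` is `a (k - 1)`). -/
def IsPosZeroSeq (f : ℝ → ℝ) (a : ℕ → ℝ) : Prop :=
  StrictMono a ∧ Set.range a = {x : ℝ | 0 < x ∧ f x = 0}

/-- The ascending sequence of all positive zeros is unique. -/
theorem IsPosZeroSeq.unique {f : ℝ → ℝ} {a b : ℕ → ℝ} (ha : IsPosZeroSeq f a)
    (hb : IsPosZeroSeq f b) : a = b :=
  (StrictMono.range_inj ha.1 hb.1).1 (ha.2.trans hb.2.symm)

/-- The ratio of consecutive coefficients of the Bessel series tends to zero. -/
theorem besselJ_coeff_ratio (ν : ℝ) :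
    Filter.Tendsto (fun n : ℕ =>
      ‖((-1) ^ n.succ / (Nat.factorial n.succ * Real.Gamma (ν + n.succ + 1)) : ℝ)‖ /
      ‖((-1) ^ n / (Nat.factorial n * Real.Gamma (ν + n + 1)) : ℝ)‖)
      Filter.atTop (nhds 0) := by
  have h1 : Filter.Tendsto (fun n : ℕ => ((n : ℝ) + 1)⁻¹ * (ν + 1 + n)⁻¹)
      Filter.atTop (nhds (0 * 0)) := by
    refine Filter.Tendsto.mul ?_ ?_
    · exact (Filter.tendsto_atTop_add_const_right _ _
        tendsto_natCast_atTop_atTop).inv_tendsto_atTop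
    · exact (Filter.tendsto_atTop_add_const_left _ _
        tendsto_natCast_atTop_atTop).inv_tendsto_atTop
  rw [mul_zero] at h1
  refine h1.congr' ?_
  filter_upwards [(tendsto_natCast_atTop_atTop (R := ℝ)).eventually_gt_atTop (-ν)] with n hn
  have hp : 0 < ν + n + 1 := by linarith
  have hG := Real.Gamma_pos_of_pos hp
  have hs : Real.Gamma (ν + n.succ + 1) = (ν + n + 1) * Real.Gamma (ν + n + 1) := by
    rw [← Real.Gamma_add_one hp.ne']
    push_cast
    ring_nf
  rw [hs, Nat.factorial_succ]
  simp only [norm_div, norm_mul, norm_pow, norm_neg, norm_one, one_pow, Real.norm_eq_abs,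
    abs_of_pos hp, abs_of_pos hG, Nat.abs_cast]
  have hf : (Nat.factorial n : ℝ) ≠ 0 := by exact_mod_cast Nat.factorial_ne_zero n
  have hn1 : (n : ℝ) + 1 ≠ 0 := by positivity
  have hG' := hG.ne'
  have hp' := hp.ne'
  have : ν + 1 + n ≠ 0 := by
    intro h
    apply hp'
    linarith
  push_cast
  field_simp
  ring

/-- The Bessel series is a power series with infinite radius of convergence times `(x / 2)^ν`;
in particular it converges, and `J_ν` is differentiable, at every `x > 0`. -/
theorem besselJ_summable_and_differentiableAt (ν : ℝ) {x : ℝ} (hx : 0 < x) :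
    Summable (fun k : ℕ => (-1) ^ k / (Nat.factorial k * Real.Gamma (ν + k + 1)) *
      (x / 2) ^ (2 * (k : ℝ) + ν)) ∧ DifferentiableAt ℝ (besselJ ν) x := by
  set c : ℕ → ℝ := fun k => (-1) ^ k / (Nat.factorial k * Real.Gamma (ν + k + 1)) with hc
  have hrad : (FormalMultilinearSeries.ofScalars ℝ c).radius = ⊤ :=
    FormalMultilinearSeries.ofScalars_radius_eq_top_of_tendsto ℝ c
      (by
        filter_upwards [(tendsto_natCast_atTop_atTop (R := ℝ)).eventually_gt_atTop (-ν)] with n hn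
        have hG := Real.Gamma_pos_of_pos (show 0 < ν + n + 1 by linarith)
        have hf : (Nat.factorial n : ℝ) ≠ 0 := by exact_mod_cast Nat.factorial_ne_zero n
        exact div_ne_zero (by simp) (mul_ne_zero hf hG.ne'))
      (besselJ_coeff_ratio ν)
  have hball := (FormalMultilinearSeries.ofScalars ℝ c).hasFPowerSeriesOnBall
    (by rw [hrad]; exact ENNReal.zero_lt_top)
  rw [hrad] at hball
  have hsum : ∀ y : ℝ, HasSum (fun k => c k * y ^ k)
      ((FormalMultilinearSeries.ofScalars ℝ c).sum y) := by
    intro y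
    have := hball.hasSum (y := y) (by simp)
    simpa [FormalMultilinearSeries.ofScalars_apply_eq, mul_comm] using this
  have hterm : ∀ z : ℝ, 0 < z → ∀ k : ℕ, c k * (z / 2) ^ (2 * (k : ℝ) + ν) =
      c k * ((z / 2) ^ 2) ^ k * (z / 2) ^ ν := by
    intro z hz k
    rw [Real.rpow_add (by positivity), mul_assoc, ← pow_mul, ← Real.rpow_natCast]
    push_cast
    rfl
  have hJ : ∀ z : ℝ, 0 < z → HasSum (fun k : ℕ => c k * (z / 2) ^ (2 * (k : ℝ) + ν))
      ((FormalMultilinearSeries.ofScalars ℝ c).sum ((z / 2) ^ 2) * (z / 2) ^ ν) := by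
    intro z hz
    simp_rw [hterm z hz]
    exact (hsum _).mul_right _
  refine ⟨(hJ x hx).summable, ?_⟩
  have hd : DifferentiableAt ℝ (fun z : ℝ =>
      (FormalMultilinearSeries.ofScalars ℝ c).sum ((z / 2) ^ 2) * (z / 2) ^ ν) x := by
    have hg : DifferentiableAt ℝ (FormalMultilinearSeries.ofScalars ℝ c).sum ((x / 2) ^ 2) :=
      (hball.analyticAt_of_mem (by simp)).differentiableAt
    refine DifferentiableAt.mul ?_ ?_
    · exact DifferentiableAt.comp (f := fun z : ℝ => (z / 2) ^ 2) x hg (by fun_prop)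
    · exact DifferentiableAt.rpow_const (by fun_prop) (Or.inl (by positivity))
  refine hd.congr_of_eventuallyEq ?_
  filter_upwards [lt_mem_nhds hx] with z hz
  exact (hJ z hz).tsum_eq

/-! Put `h(x) = x J_ν'(x) = ν J_ν(x) - x J_(ν+1)(x)`, so that Bessel's equation reads `x h' = (ν² -
x²) J_ν`. Then `h' J_ν - h J_ν' = -(h² + (x² - ν²) J_ν²) / x`, which is negative for `x > ν` because
`J_ν` and `J_(ν+1)` have no common zero. Since `x J_(ν+1) = ν J_ν - h`, the Wronskian of `h` and `x
J_(ν+1)` is `ν` times this one, so both values of `m` are covered. On `(0, ν]` the functions `h`,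
`J_ν`, `J_(ν+1)` are positive, and `J_ν` has arbitrarily large zeros (`exists_besselJ_zero`);
Sturm's argument `exists_interlacing` does the rest. -/

/-! ### Zero sequences and Sturm interlacing. -/

open Filter Topology Set in
theorem exists_strictMono_range_eq {S : Set ℝ} (hfin : ∀ M, (S ∩ Iic M).Finite)
    (hunb : ∀ M, ∃ x ∈ S, M < x) : ∃ a : ℕ → ℝ, StrictMono a ∧ range a = S := by
  classical
  have hIic : ∀ b : S, (Set.Iic b).Finite := fun b =>
    Set.Finite.of_finite_image ((hfin b).subset (by
      rintro _ ⟨y, hy, rfl⟩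
      exact ⟨y.2, hy⟩)) Subtype.val_injective.injOn
  -- A locally finite linear order with a least element and no maximum is order isomorphic to `ℕ`.
  let _ : LocallyFiniteOrderBot S := LocallyFiniteOrderBot.ofIic S
    (fun b => (hIic b).toFinset) (fun a b => by simp)
  let _ : LocallyFiniteOrder S := LocallyFiniteOrder.ofFiniteIcc
    (fun a b => (hIic b).subset Set.Icc_subset_Iic_self)
  obtain ⟨x₀, hx₀, -⟩ := hunb 0
  have : Nonempty S := ⟨⟨x₀, hx₀⟩⟩
  have : NoMaxOrder S := ⟨fun a => by
    obtain ⟨y, hy, h⟩ := hunb a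
    exact ⟨⟨y, hy⟩, h⟩⟩
  obtain ⟨b, -, hb⟩ := (hIic ⟨x₀, hx₀⟩).exists_minimalFor id _ ⟨⟨x₀, hx₀⟩, Set.mem_Iic.2 le_rfl⟩
  let _ : OrderBot S :=
    { bot := b
      bot_le := fun y => by
        rcases le_total y ⟨x₀, hx₀⟩ with h | h
        · rcases le_total b y with h' | h'
          · exact h'
          · exact hb h h'
        · rcases le_total b ⟨x₀, hx₀⟩ with h' | h'
          · exact h'.trans h
          · exact (hb (Set.mem_Iic.2 le_rfl) h').trans h }
  let _ : SuccOrder S := LinearLocallyFiniteOrder.succOrder S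
  let _ : PredOrder S := LinearLocallyFiniteOrder.predOrder S
  let e : S ≃o ℕ := orderIsoNatOfLinearSuccPredArch
  refine ⟨fun n => e.symm n, fun m n h => e.symm.strictMono h, ?_⟩
  rw [show (fun n => (e.symm n : ℝ)) = Subtype.val ∘ e.symm from rfl,
    e.symm.surjective.range_comp, Subtype.range_coe]

/-- Between two zeros of `A` there is a zero of `B` if the Wronskian does not vanish. -/
theorem exists_zero_between {A A' B B' : ℝ → ℝ} {c a b : ℝ}
    (hA : ∀ x, c < x → HasDerivAt A (A' x) x) (hB : ∀ x, c < x → HasDerivAt B (B' x) x)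
    (hW : ∀ x, c < x → A' x * B x - A x * B' x ≠ 0) (hca : c < a) (hab : a < b)
    (ha : A a = 0) (hb : A b = 0) : ∃ z, a < z ∧ z < b ∧ B z = 0 := by
  by_contra! h
  have hne : ∀ x ∈ Set.Icc a b, B x ≠ 0 := by
    rintro x ⟨h1, h2⟩ h0
    have hw := hW x (hca.trans_le h1)
    rcases h1.eq_or_lt with rfl | h1
    · simp [ha, h0] at hw
    rcases h2.eq_or_lt with rfl | h2
    · simp [hb, h0] at hw
    exact h x h1 h2 h0
  -- Rolle applied to `A / B`, whose derivative is the Wronskian over `B²`.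
  have hd : ∀ x ∈ Set.Icc a b,
      HasDerivAt (fun x => A x / B x) ((A' x * B x - A x * B' x) / B x ^ 2) x := fun x hx =>
    (hA x (hca.trans_le hx.1)).fun_div (hB x (hca.trans_le hx.1)) (hne x hx)
  obtain ⟨z, hz, h0⟩ := exists_hasDerivAt_eq_zero hab
    (fun x hx => (hd x hx).continuousAt.continuousWithinAt) (by simp [ha, hb])
    (fun x hx => hd x (Set.Ioo_subset_Icc_self hx))
  exact div_ne_zero (hW z (hca.trans hz.1))
    (pow_ne_zero 2 (hne z (Set.Ioo_subset_Icc_self hz))) h0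

/-- If the Wronskian is negative and `A`, `B` start out positive, then `A` vanishes before `B`. -/
theorem exists_zero_before {A A' B B' : ℝ → ℝ} {c b : ℝ}
    (hA : ∀ x, c ≤ x → HasDerivAt A (A' x) x) (hB : ∀ x, c ≤ x → HasDerivAt B (B' x) x)
    (hW : ∀ x, c < x → A' x * B x - A x * B' x < 0) (hAc : 0 < A c) (hBc : 0 < B c)
    (hcb : c < b) (hb : B b = 0) : ∃ z, c < z ∧ z < b ∧ A z = 0 := by
  by_contra! h
  have hne : ∀ x ∈ Set.Icc c b, A x ≠ 0 := by
    rintro x ⟨h1, h2⟩ h0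
    rcases h1.eq_or_lt with rfl | h1
    · exact hAc.ne' h0
    rcases h2.eq_or_lt with rfl | h2
    · simpa [hb, h0] using hW x h1
    exact h x h1 h2 h0
  have hd : ∀ x ∈ Set.Icc c b,
      HasDerivAt (fun x => B x / A x) ((B' x * A x - B x * A' x) / A x ^ 2) x := fun x hx =>
    (hB x hx.1).fun_div (hA x hx.1) (hne x hx)
  -- `B / A` cannot fall from a positive value at `c` to `0` at `b`.
  have hmono : MonotoneOn (fun x => B x / A x) (Set.Icc c b) := by
    refine monotoneOn_of_hasDerivWithinAt_nonneg (convex_Icc c b)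
      (fun x hx => (hd x hx).continuousAt.continuousWithinAt)
      (fun x hx => (hd x (interior_subset hx)).hasDerivWithinAt) fun x hx => ?_
    rw [interior_Icc] at hx
    exact div_nonneg (by linarith [hW x hx.1]) (sq_nonneg _)
  have := hmono (Set.left_mem_Icc.2 hcb.le) (Set.right_mem_Icc.2 hcb.le) hcb.le
  simp only [hb, zero_div] at this
  exact absurd this (not_le.2 (div_pos hBc hAc))

-- Infinitely many zeros would accumulate in the compact `[c, M]`, but zeros beyond `c` are simple,
-- hence isolated.
open Filter Topology Set in
theorem finite_zeros_inter_Iic {A A' : ℝ → ℝ} {c : ℝ} (hc : 0 < c)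
    (hA : ∀ x, 0 < x → HasDerivAt A (A' x) x) (hpos : ∀ x, 0 < x → x ≤ c → A x ≠ 0)
    (hW : ∀ x, c < x → A x = 0 → A' x ≠ 0) (M : ℝ) :
    ({x : ℝ | 0 < x ∧ A x = 0} ∩ Iic M).Finite := by
  by_contra hinf
  have hsub : {x : ℝ | 0 < x ∧ A x = 0} ∩ Iic M ⊆ Icc c M := fun x hx =>
    ⟨not_lt.1 fun h => hpos x hx.1.1 h.le hx.1.2, hx.2⟩
  obtain ⟨z, hz, hacc⟩ := Set.Infinite.exists_accPt_of_subset_isCompact hinf isCompact_Icc hsub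
  have hz0 : 0 < z := hc.trans_le hz.1
  have hne : ∀ᶠ y in 𝓝[≠] z, A y ≠ 0 := by
    by_cases h0 : A z = 0
    · have hcz : c < z := hz.1.lt_of_ne fun h => hpos z hz0 h.symm.le h0
      exact (hA z hz0).eventually_ne (hW z hcz h0)
    · exact ((hA z hz0).continuousAt.eventually_ne h0).filter_mono nhdsWithin_le_nhds
  obtain ⟨y, hy, hy'⟩ := ((accPt_iff_frequently_nhdsNE.1 hacc).and_eventually hne).exists
  exact hy' hy.1.2

/-- Sturm interlacing from a negative Wronskian. -/
theorem exists_interlacing {A A' B B' : ℝ → ℝ} {c : ℝ} (hc : 0 < c)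
    (hA : ∀ x, 0 < x → HasDerivAt A (A' x) x) (hB : ∀ x, 0 < x → HasDerivAt B (B' x) x)
    (hAc : ∀ x, 0 < x → x ≤ c → 0 < A x) (hBc : ∀ x, 0 < x → x ≤ c → 0 < B x)
    (hW : ∀ x, c < x → A' x * B x - A x * B' x < 0)
    (hAz : ∀ M, ∃ x, M < x ∧ A x = 0) :
    ∃ a b : ℕ → ℝ, IsPosZeroSeq A a ∧ IsPosZeroSeq B b ∧
      0 < a 0 ∧ ∀ k : ℕ, a k < b k ∧ b k < a (k + 1) := by
  have hAB : ∀ x y, c < x → x < y → A x = 0 → A y = 0 → ∃ z, x < z ∧ z < y ∧ B z = 0 :=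
    fun x y => exists_zero_between (fun x hx => hA x (hc.trans hx)) (fun x hx => hB x (hc.trans hx))
      (fun x hx => (hW x hx).ne)
  have hBA : ∀ x y, c < x → x < y → B x = 0 → B y = 0 → ∃ z, x < z ∧ z < y ∧ A z = 0 :=
    fun x y => exists_zero_between (fun x hx => hB x (hc.trans hx)) (fun x hx => hA x (hc.trans hx))
      (fun x hx => by have := hW x hx; intro h; linarith)
  have hAgt : ∀ x, 0 < x → A x = 0 → c < x := fun x hx h =>
    not_le.1 fun h' => (hAc x hx h').ne' h
  have hBgt : ∀ x, 0 < x → B x = 0 → c < x := fun x hx h =>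
    not_le.1 fun h' => (hBc x hx h').ne' h
  obtain ⟨a, ha, har⟩ := exists_strictMono_range_eq
    (finite_zeros_inter_Iic hc hA (fun x h h' => (hAc x h h').ne')
      (fun x hx h h' => by simpa [h, h'] using hW x hx))
    (fun M => by
      obtain ⟨x, hx, h⟩ := hAz (max M 0)
      exact ⟨x, ⟨(le_max_right _ _).trans_lt hx, h⟩, (le_max_left _ _).trans_lt hx⟩)
  obtain ⟨b, hb, hbr⟩ := exists_strictMono_range_eq
    (finite_zeros_inter_Iic hc hB (fun x h h' => (hBc x h h').ne')
      (fun x hx h h' => by simpa [h, h'] using hW x hx))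
    (fun M => by
      obtain ⟨x, hx, h⟩ := hAz (max M c)
      obtain ⟨y, hy, h'⟩ := hAz x
      have hcx : c < x := (le_max_right _ _).trans_lt hx
      obtain ⟨z, hz, -, h0⟩ := hAB x y hcx hy h h'
      exact ⟨z, ⟨hc.trans (hcx.trans hz), h0⟩, ((le_max_left _ _).trans_lt hx).trans hz⟩)
  have haz : ∀ k, 0 < a k ∧ A (a k) = 0 := fun k => by
    have : a k ∈ {x : ℝ | 0 < x ∧ A x = 0} := har ▸ Set.mem_range_self k
    exact this
  have hbz : ∀ k, 0 < b k ∧ B (b k) = 0 := fun k => by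
    have : b k ∈ {x : ℝ | 0 < x ∧ B x = 0} := hbr ▸ Set.mem_range_self k
    exact this
  have hac : ∀ k, c < a k := fun k => hAgt _ (haz k).1 (haz k).2
  have hbc : ∀ k, c < b k := fun k => hBgt _ (hbz k).1 (hbz k).2
  have hax : ∀ z, c < z → A z = 0 → ∃ i, a i = z := fun z hz h => by
    have : z ∈ Set.range a := har ▸ ⟨hc.trans hz, h⟩
    exact this
  have hbx : ∀ z, c < z → B z = 0 → ∃ i, b i = z := fun z hz h => by
    have : z ∈ Set.range b := hbr ▸ ⟨hc.trans hz, h⟩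
    exact this
  refine ⟨a, b, ⟨ha, har⟩, ⟨hb, hbr⟩, (haz 0).1, fun k => ?_⟩
  have hnext : ∀ k, ∃ i, a k < b i ∧ b i < a (k + 1) := fun k => by
    obtain ⟨z, hz, hz', h0⟩ := hAB _ _ (hac k) (ha k.lt_succ_self) (haz k).2 (haz _).2
    obtain ⟨i, rfl⟩ := hbx z ((hac k).trans hz) h0
    exact ⟨i, hz, hz'⟩
  induction k with
  | zero =>
    constructor
    · obtain ⟨z, hz, hz', h0⟩ := exists_zero_before (fun x hx => hA x (hc.trans_le hx))
        (fun x hx => hB x (hc.trans_le hx)) hW (hAc c hc le_rfl) (hBc c hc le_rfl) (hbc 0)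
        (hbz 0).2
      obtain ⟨i, rfl⟩ := hax z hz h0
      exact (ha.monotone i.zero_le).trans_lt hz'
    · obtain ⟨i, -, h⟩ := hnext 0
      exact (hb.monotone i.zero_le).trans_lt h
  | succ k ih =>
    constructor
    · obtain ⟨z, hz, hz', h0⟩ := hBA _ _ (hbc k) (hb k.lt_succ_self) (hbz k).2 (hbz _).2
      -- A zero `a i` beyond `b k > a k` has `i ≥ k + 1`, so `a (k + 1) ≤ a i`.
      obtain ⟨i, rfl⟩ := hax z ((hbc k).trans hz) h0
      exact (ha.monotone (ha.lt_iff_lt.1 (ih.1.trans hz))).trans_lt hz'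
    · obtain ⟨i, h, h'⟩ := hnext (k + 1)
      exact (hb.monotone (hb.lt_iff_lt.1 (ih.2.trans h))).trans_lt h'

/-! ### Recurrences and derivatives of Bessel functions. -/

/-- The coefficients of the entire function `y ↦ J_ν(2√y) y^(-ν/2)`. -/
noncomputable def besselCoeff (ν : ℝ) (k : ℕ) : ℝ :=
  (-1) ^ k / (Nat.factorial k * Real.Gamma (ν + k + 1))

/-- The entire function `y ↦ J_ν(2√y) y^(-ν/2)`. -/
noncomputable def besselSeries (ν y : ℝ) : ℝ := ∑' k : ℕ, besselCoeff ν k * y ^ k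

theorem besselCoeff_succ (ν : ℝ) (k : ℕ) :
    besselCoeff ν (k + 1) * (k + 1) = -besselCoeff (ν + 1) k := by
  have hk : (k : ℝ) + 1 ≠ 0 := by positivity
  have hf : (Nat.factorial k : ℝ) ≠ 0 := by exact_mod_cast Nat.factorial_ne_zero k
  have : ν + (k + 1 : ℕ) + 1 = ν + 1 + k + 1 := by push_cast; ring
  rw [besselCoeff, besselCoeff, this, Nat.factorial_succ, pow_succ]
  push_cast
  by_cases hG : Real.Gamma (ν + 1 + k + 1) = 0
  · simp [hG]
  · field_simp

theorem besselCoeff_eq {ν : ℝ} (hν : -1 < ν) (k : ℕ) :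
    besselCoeff ν k = (ν + 1 + k) * besselCoeff (ν + 1) k := by
  have hp : 0 < ν + k + 1 := by linarith [k.cast_nonneg (α := ℝ)]
  have hG := (Real.Gamma_pos_of_pos hp).ne'
  have hf : (Nat.factorial k : ℝ) ≠ 0 := by exact_mod_cast Nat.factorial_ne_zero k
  have h : ν + 1 + k = ν + k + 1 := by ring
  rw [besselCoeff, besselCoeff, h, Real.Gamma_add_one hp.ne']
  have := hp.ne'
  field_simp

theorem besselCoeff_mul_rpow (ν : ℝ) {s : ℝ} (hs : 0 < s) (k : ℕ) :
    besselCoeff ν k * s ^ (2 * (k : ℝ) + ν) = besselCoeff ν k * (s ^ 2) ^ k * s ^ ν := by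
  rw [Real.rpow_add hs, mul_assoc, ← pow_mul, ← Real.rpow_natCast]
  push_cast
  rfl

theorem summable_norm_besselCoeff_mul_pow (ν y : ℝ) :
    Summable fun k : ℕ => ‖besselCoeff ν k * y ^ k‖ := by
  have hs : 0 < |y| + 1 := by positivity
  -- This `x` satisfies `(x / 2)² = |y| + 1`; the added `1` keeps `x` positive when `y = 0`.
  have h := (besselJ_summable_and_differentiableAt ν (x := 2 * √(|y| + 1)) (by positivity)).1
  have h2 : 2 * √(|y| + 1) / 2 = √(|y| + 1) := by ring
  rw [h2] at h
  replace h := (summable_congr (besselCoeff_mul_rpow ν (Real.sqrt_pos.2 hs))).1 h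
  simp_rw [Real.sq_sqrt hs.le] at h
  rw [summable_mul_right_iff (by positivity)] at h
  refine h.norm.of_nonneg_of_le (fun _ => norm_nonneg _) fun k => ?_
  rw [norm_mul, norm_mul, norm_pow, norm_pow, Real.norm_eq_abs y, Real.norm_of_nonneg hs.le]
  gcongr
  linarith

theorem summable_besselCoeff_mul_pow (ν y : ℝ) : Summable fun k : ℕ => besselCoeff ν k * y ^ k :=
  (summable_norm_besselCoeff_mul_pow ν y).of_norm

theorem hasSum_besselSeries_deriv (ν y : ℝ) :
    HasSum (fun k : ℕ => besselCoeff ν k * (k * y ^ (k - 1))) (-besselSeries (ν + 1) y) := by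
  rw [← hasSum_nat_add_iff' 1]
  simp only [Finset.range_one, Finset.sum_singleton, Nat.cast_zero, zero_mul, mul_zero, sub_zero,
    Nat.add_sub_cancel]
  refine (summable_besselCoeff_mul_pow (ν + 1) y).hasSum.neg.congr_fun fun k => ?_
  rw [← neg_mul, ← besselCoeff_succ]
  push_cast
  ring

theorem hasDerivAt_besselSeries (ν y : ℝ) :
    HasDerivAt (besselSeries ν) (-besselSeries (ν + 1) y) y := by
  rw [← (hasSum_besselSeries_deriv ν y).tsum_eq]
  have hR : 0 < |y| + 1 := by positivity
  refine hasDerivAt_tsum_of_isPreconnected (g := fun k z => besselCoeff ν k * z ^ k)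
    (g' := fun k z => besselCoeff ν k * (k * z ^ (k - 1))) (t := Metric.ball 0 (|y| + 1)) (y₀ := 0)
    (hasSum_besselSeries_deriv ν (|y| + 1)).summable.norm Metric.isOpen_ball
    (convex_ball _ _).isPreconnected (fun k z _ => (hasDerivAt_pow k z).const_mul _)
    (fun k z hz => ?_) (by simpa using hR) (summable_besselCoeff_mul_pow ν 0) (by simp)
  have hz' : |z| ≤ |y| + 1 := by simpa using (mem_ball_zero_iff.1 hz).le
  simp only [norm_mul, norm_pow, Real.norm_eq_abs, abs_of_pos hR]
  gcongr

theorem continuous_besselSeries (ν : ℝ) : Continuous (besselSeries ν) :=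
  continuous_iff_continuousAt.2 fun y => (hasDerivAt_besselSeries ν y).continuousAt

theorem besselSeries_zero_pos {ν : ℝ} (hν : -1 < ν) : 0 < besselSeries ν 0 := by
  have hG := Real.Gamma_pos_of_pos (show 0 < ν + 1 by linarith)
  rw [besselSeries, tsum_eq_single 0 (fun k hk => by simp [hk])]
  simpa [besselCoeff] using hG

theorem besselSeries_recurrence {ν : ℝ} (hν : -1 < ν) (y : ℝ) :
    besselSeries ν y = (ν + 1) * besselSeries (ν + 1) y - y * besselSeries (ν + 1 + 1) y := by
  have h := ((summable_besselCoeff_mul_pow (ν + 1) y).hasSum.mul_left (ν + 1)).add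
    ((hasSum_besselSeries_deriv (ν + 1) y).mul_left y)
  rw [sub_eq_add_neg, ← mul_neg]
  refine Eq.trans ?_ h.tsum_eq
  refine tsum_congr fun k => ?_
  rw [besselCoeff_eq hν]
  rcases k with _ | k
  · simp
  · simp only [Nat.add_sub_cancel, pow_succ]
    ring

theorem besselJ_eq (ν : ℝ) {x : ℝ} (hx : 0 < x) :
    besselJ ν x = besselSeries ν ((x / 2) ^ 2) * (x / 2) ^ ν := by
  rw [besselSeries, ← tsum_mul_right]
  exact tsum_congr fun k => besselCoeff_mul_rpow ν (half_pos hx) k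

theorem besselJ_recurrence {ν : ℝ} (hν : -1 < ν) {x : ℝ} (hx : 0 < x) :
    besselJ ν x = 2 * (ν + 1) / x * besselJ (ν + 1) x - besselJ (ν + 1 + 1) x := by
  rw [besselJ_eq _ hx, besselJ_eq _ hx, besselJ_eq _ hx, besselSeries_recurrence hν]
  obtain ⟨s, rfl⟩ : ∃ s, x = 2 * s := ⟨x / 2, by ring⟩
  have hs : s ≠ 0 := by
    rintro rfl
    simp at hx
  rw [mul_div_cancel_left₀ _ (two_ne_zero' ℝ)]
  simp only [Real.rpow_add_one hs]
  field_simp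

theorem hasDerivAt_besselJ (ν : ℝ) {x : ℝ} (hx : 0 < x) :
    HasDerivAt (besselJ ν) (ν / x * besselJ ν x - besselJ (ν + 1) x) x := by
  have h2 := half_pos hx
  have hlin : HasDerivAt (fun z : ℝ => z / 2) (1 / 2) x := (hasDerivAt_id x).div_const 2
  have h := ((hasDerivAt_besselSeries ν ((x / 2) ^ 2)).comp x (hlin.fun_pow 2)).mul
    (hlin.rpow_const (p := ν) (Or.inl h2.ne'))
  refine (h.congr_of_eventuallyEq ?_).congr_deriv ?_
  · filter_upwards [lt_mem_nhds hx] with z hz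
    exact besselJ_eq ν hz
  · rw [besselJ_eq _ hx, besselJ_eq _ hx, Real.rpow_add_one h2.ne', Real.rpow_sub_one h2.ne']
    simp only [Function.comp_apply, Nat.cast_ofNat]
    field_simp
    ring

theorem hasDerivAt_besselJ_add_one {ν : ℝ} (hν : -1 < ν) {x : ℝ} (hx : 0 < x) :
    HasDerivAt (besselJ (ν + 1)) (besselJ ν x - (ν + 1) / x * besselJ (ν + 1) x) x := by
  refine (hasDerivAt_besselJ (ν + 1) hx).congr_deriv ?_
  rw [besselJ_recurrence hν hx]
  ring

/-! ### Positivity on `(0, ν]` and absence of common zeros. -/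

-- After division by `(x / 2)^ν` (or `(x / 2)^(ν + 1)`) each function extends continuously to `0`
-- with a positive value there.
open Filter Topology Set in
theorem eventually_besselJ_pos {ν : ℝ} (hν : 0 < ν) :
    ∀ᶠ x in 𝓝[>] (0 : ℝ), 0 < besselJ ν x ∧ 0 < besselJ (ν + 1) x ∧
      0 < ν * besselJ ν x - x * besselJ (ν + 1) x := by
  have hc : ∀ μ, Continuous fun x : ℝ => besselSeries μ ((x / 2) ^ 2) := fun μ =>
    (continuous_besselSeries μ).comp (by fun_prop)
  have h1 : ∀ μ : ℝ, -1 < μ → ∀ᶠ x in 𝓝 (0 : ℝ), 0 < besselSeries μ ((x / 2) ^ 2) := fun μ hμ =>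
    (hc μ).continuousAt.eventually (lt_mem_nhds (by simpa using besselSeries_zero_pos hμ))
  have hc3 : Continuous fun x : ℝ => ν * besselSeries ν ((x / 2) ^ 2) -
      x * (besselSeries (ν + 1) ((x / 2) ^ 2) * (x / 2)) :=
    ((hc ν).const_mul ν).sub (continuous_id.mul ((hc (ν + 1)).mul (by fun_prop)))
  have h3 : ∀ᶠ x in 𝓝 (0 : ℝ), 0 < ν * besselSeries ν ((x / 2) ^ 2) -
      x * (besselSeries (ν + 1) ((x / 2) ^ 2) * (x / 2)) :=
    hc3.continuousAt.eventually (lt_mem_nhds (by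
      simpa using mul_pos hν (besselSeries_zero_pos (show -1 < ν by linarith))))
  filter_upwards [(h1 ν (by linarith)).filter_mono nhdsWithin_le_nhds,
    (h1 (ν + 1) (by linarith)).filter_mono nhdsWithin_le_nhds,
    h3.filter_mono nhdsWithin_le_nhds, self_mem_nhdsWithin] with x hx1 hx2 hx3 hx
  have hx : 0 < x := hx
  have hs : 0 < x / 2 := half_pos hx
  rw [besselJ_eq _ hx, besselJ_eq _ hx]
  refine ⟨by positivity, by positivity, ?_⟩
  rw [Real.rpow_add_one hs.ne']
  have := mul_pos hx3 (Real.rpow_pos_of_pos hs ν)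
  linarith

theorem exists_besselJ_pos {ν : ℝ} (hν : 0 < ν) {x : ℝ} (hx : 0 < x) :
    ∃ e, 0 < e ∧ e < x ∧ 0 < besselJ ν e ∧ 0 < besselJ (ν + 1) e ∧
      0 < ν * besselJ ν e - e * besselJ (ν + 1) e := by
  obtain ⟨e, h, h'⟩ := ((eventually_besselJ_pos hν).and (Ioo_mem_nhdsGT hx)).exists
  exact ⟨e, h'.1, h'.2, h⟩

theorem hasDerivAt_mul_deriv_besselJ {ν : ℝ} (hν : 0 < ν) {x : ℝ} (hx : 0 < x) :
    HasDerivAt (fun x => ν * besselJ ν x - x * besselJ (ν + 1) x)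
      ((ν ^ 2 / x - x) * besselJ ν x) x := by
  refine (((hasDerivAt_besselJ ν hx).const_mul ν).fun_sub ((hasDerivAt_id x).fun_mul
    (hasDerivAt_besselJ_add_one (by linarith) hx))).congr_deriv ?_
  simp only [id]
  field_simp
  ring

/-- `J_ν` and `J_(ν+1)` have no common positive zero. -/
theorem sq_besselJ_add_sq_pos {ν : ℝ} (hν : 0 < ν) {x : ℝ} (hx : 0 < x) :
    0 < besselJ ν x ^ 2 + besselJ (ν + 1) x ^ 2 := by
  obtain ⟨e, he, hex, hf, hg, -⟩ := exists_besselJ_pos hν hx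
  -- The cross terms in the derivative of `J_ν² + J_(ν+1)²` cancel; a high enough power of `z` as a
  -- factor makes the remaining coefficients nonnegative.
  obtain ⟨n, hn⟩ := exists_nat_ge (2 * ν + 2)
  have hd : ∀ z, 0 < z → HasDerivAt
      (fun z => z ^ (n + 1) * (besselJ ν z ^ 2 + besselJ (ν + 1) z ^ 2))
      (z ^ n * ((n + 1 + 2 * ν) * besselJ ν z ^ 2 +
        (n + 1 - 2 * (ν + 1)) * besselJ (ν + 1) z ^ 2)) z := fun z hz => by
    refine ((hasDerivAt_pow (n + 1) z).fun_mul (((hasDerivAt_besselJ ν hz).fun_pow 2).fun_add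
      ((hasDerivAt_besselJ_add_one (by linarith) hz).fun_pow 2))).congr_deriv ?_
    simp only [Nat.add_sub_cancel, pow_succ]
    push_cast
    field_simp
    ring
  have hmono : MonotoneOn (fun z => z ^ (n + 1) * (besselJ ν z ^ 2 + besselJ (ν + 1) z ^ 2))
      (Set.Ioi 0) := by
    refine monotoneOn_of_hasDerivWithinAt_nonneg (convex_Ioi 0)
      (fun z hz => (hd z hz).continuousAt.continuousWithinAt)
      (fun z hz => (hd z (interior_subset hz)).hasDerivWithinAt) fun z hz => ?_
    have hz : 0 < z := interior_subset hz
    have : 0 ≤ n + 1 - 2 * (ν + 1) := by linarith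
    positivity
  have h := hmono he hx hex.le
  have h0 : 0 < e ^ (n + 1) * (besselJ ν e ^ 2 + besselJ (ν + 1) e ^ 2) := by positivity
  exact (pos_iff_pos_of_mul_pos (h0.trans_le h)).1 (by positivity)

/-- By Bessel's equation `x J_ν' J_ν` is nondecreasing up to `ν`. It is positive near `0`, so
neither factor can vanish. -/
theorem besselJ_pos_and_mul_deriv_pos {ν : ℝ} (hν : 0 < ν) {x : ℝ} (hx : 0 < x) (hxν : x ≤ ν) :
    0 < besselJ ν x ∧ 0 < ν * besselJ ν x - x * besselJ (ν + 1) x := by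
  obtain ⟨e, he, hex, hf, -, hh⟩ := exists_besselJ_pos hν hx
  have hd : ∀ z, 0 < z → HasDerivAt
      (fun z => (ν * besselJ ν z - z * besselJ (ν + 1) z) * besselJ ν z)
      ((ν ^ 2 - z ^ 2) / z * besselJ ν z ^ 2 +
        (ν * besselJ ν z - z * besselJ (ν + 1) z) ^ 2 / z) z := fun z hz => by
    refine ((hasDerivAt_mul_deriv_besselJ hν hz).fun_mul (hasDerivAt_besselJ ν hz)).congr_deriv ?_
    field_simp
  have hmono : MonotoneOn (fun z => (ν * besselJ ν z - z * besselJ (ν + 1) z) * besselJ ν z)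
      (Set.Icc e x) := by
    refine monotoneOn_of_hasDerivWithinAt_nonneg (convex_Icc e x)
      (fun z hz => (hd z (he.trans_le hz.1)).continuousAt.continuousWithinAt)
      (fun z hz => (hd z (he.trans_le (interior_subset hz).1)).hasDerivWithinAt) fun z hz => ?_
    have hz := interior_subset hz
    have hz0 : 0 < z := he.trans_le hz.1
    have : 0 ≤ ν ^ 2 - z ^ 2 := by nlinarith [hz.2]
    positivity
  have hpos : ∀ z ∈ Set.Icc e x, 0 < (ν * besselJ ν z - z * besselJ (ν + 1) z) * besselJ ν z :=
    fun z hz => (mul_pos hh hf).trans_le (hmono (Set.left_mem_Icc.2 hex.le) hz hz.1)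
  have hfx : 0 < besselJ ν x := by
    by_contra! hle
    have hcont : ContinuousOn (besselJ ν) (Set.Icc e x) := fun z hz =>
      (hasDerivAt_besselJ ν (he.trans_le hz.1)).continuousAt.continuousWithinAt
    obtain ⟨z, hz, h0⟩ := intermediate_value_Icc' hex.le hcont ⟨hle, hf.le⟩
    simpa [h0] using hpos z hz
  exact ⟨hfx, (pos_iff_pos_of_mul_pos (hpos x (Set.right_mem_Icc.2 hex.le))).2 hfx⟩

/-- The derivative of `x^(ν+1) J_(ν+1)` is `x^(ν+1) J_ν`, which is positive here. -/
theorem besselJ_add_one_pos {ν : ℝ} (hν : 0 < ν) {x : ℝ} (hx : 0 < x) (hxν : x ≤ ν) :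
    0 < besselJ (ν + 1) x := by
  obtain ⟨e, he, hex, -, hg, -⟩ := exists_besselJ_pos hν hx
  have hd : ∀ z, 0 < z → HasDerivAt (fun z => z ^ (ν + 1) * besselJ (ν + 1) z)
      (z ^ (ν + 1) * besselJ ν z) z := fun z hz => by
    refine ((Real.hasDerivAt_rpow_const (p := ν + 1) (Or.inl hz.ne')).fun_mul
      (hasDerivAt_besselJ_add_one (by linarith) hz)).congr_deriv ?_
    rw [Real.rpow_sub_one hz.ne']
    field_simp
    ring
  have hmono : MonotoneOn (fun z => z ^ (ν + 1) * besselJ (ν + 1) z) (Set.Icc e x) := by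
    refine monotoneOn_of_hasDerivWithinAt_nonneg (convex_Icc e x)
      (fun z hz => (hd z (he.trans_le hz.1)).continuousAt.continuousWithinAt)
      (fun z hz => (hd z (he.trans_le (interior_subset hz).1)).hasDerivWithinAt) fun z hz => ?_
    have hz := interior_subset hz
    have hz0 : 0 < z := he.trans_le hz.1
    have := (besselJ_pos_and_mul_deriv_pos hν hz0 (hz.2.trans hxν)).1
    positivity
  have h := hmono (Set.left_mem_Icc.2 hex.le) (Set.right_mem_Icc.2 hex.le) hex.le
  have h0 : 0 < e ^ (ν + 1) * besselJ (ν + 1) e := by positivity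
  exact (pos_iff_pos_of_mul_pos (h0.trans_le h)).1 (by positivity)

/-! ### Existence of zeros, Wronskians and the conclusion. -/

/-- Without zeros beyond `M` the angle `arctan (J_(ν+1) / J_ν)` would be smooth there, with
derivative at least `1/2` once `x ≥ 2ν + 1`. Over a length of `8` it would gain `4 > π`. -/
theorem exists_besselJ_zero {ν : ℝ} (hν : 0 < ν) (M : ℝ) : ∃ x, M < x ∧ besselJ ν x = 0 := by
  by_contra! hne
  set a := max M (2 * ν + 1) + 1
  have haM : M < a := (le_max_left _ _).trans_lt (lt_add_one _)
  have haν : 2 * ν + 1 ≤ a := (le_max_right _ _).trans (lt_add_one _).le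
  have hd : ∀ x, a ≤ x → HasDerivAt
      (fun x => Real.arctan (besselJ (ν + 1) x / besselJ ν x) - x / 2)
      (1 / (1 + (besselJ (ν + 1) x / besselJ ν x) ^ 2) * (1 - (2 * ν + 1) / x *
        (besselJ (ν + 1) x / besselJ ν x) + (besselJ (ν + 1) x / besselJ ν x) ^ 2) - 1 / 2) x := by
    intro x hx
    have hx0 : 0 < x := by linarith
    have hf := hne x (haM.trans_le hx)
    refine ((((hasDerivAt_besselJ_add_one (by linarith) hx0).fun_div (hasDerivAt_besselJ ν hx0)
      hf).arctan).fun_sub ((hasDerivAt_id x).div_const 2)).congr_deriv ?_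
    congr 2
    field_simp
    ring
  have hmono : MonotoneOn (fun x => Real.arctan (besselJ (ν + 1) x / besselJ ν x) - x / 2)
      (Set.Ici a) := by
    refine monotoneOn_of_hasDerivWithinAt_nonneg (convex_Ici a)
      (fun z hz => (hd z hz).continuousAt.continuousWithinAt)
      (fun z hz => (hd z (interior_subset hz)).hasDerivWithinAt) fun z hz => ?_
    have hz : a ≤ z := interior_subset hz
    have hz0 : 0 < z := by linarith
    generalize besselJ (ν + 1) z / besselJ ν z = p
    have hq : (2 * ν + 1) / z ≤ 1 := (div_le_one hz0).2 (haν.trans hz)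
    have hq0 : 0 ≤ (2 * ν + 1) / z := by positivity
    generalize (2 * ν + 1) / z = q at hq hq0
    rw [sub_nonneg, one_div_mul_eq_div, le_div_iff₀ (by positivity)]
    -- The claim amounts to `1 - 2qp + p² ≥ 0`, true since `0 ≤ q ≤ 1`.
    nlinarith [sq_nonneg (p - q), mul_nonneg hq0 (sub_nonneg.2 hq)]
  have h := hmono (Set.mem_Ici.2 le_rfl) (Set.mem_Ici.2 (show a ≤ a + 8 by linarith))
    (by linarith)
  have h1 := Real.arctan_lt_pi_div_two (besselJ (ν + 1) (a + 8) / besselJ ν (a + 8))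
  have h2 := Real.neg_pi_div_two_lt_arctan (besselJ (ν + 1) a / besselJ ν a)
  have h3 := Real.pi_lt_four
  simp only at h
  linarith

/-- This quantity is `-x` times the Wronskian of `x J_ν'` and `J_ν`. -/
theorem sq_mul_deriv_add_pos {ν : ℝ} (hν : 0 < ν) {x : ℝ} (hx : ν < x) :
    0 < (ν * besselJ ν x - x * besselJ (ν + 1) x) ^ 2 + (x ^ 2 - ν ^ 2) * besselJ ν x ^ 2 := by
  have hx0 := hν.trans hx
  have h1 : 0 < x ^ 2 - ν ^ 2 := by nlinarith
  by_cases hf : besselJ ν x = 0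
  · have h := sq_besselJ_add_sq_pos hν hx0
    have hg : besselJ (ν + 1) x ≠ 0 := by
      intro hg
      simp [hf, hg] at h
    simp only [hf]
    have : 0 < (x * besselJ (ν + 1) x) ^ 2 := by positivity
    linarith
  · positivity

theorem wronskian_mul_deriv_besselJ_neg {ν : ℝ} (hν : 0 < ν) {x : ℝ} (hx : ν < x) :
    (ν ^ 2 / x - x) * besselJ ν x * besselJ ν x - (ν * besselJ ν x - x * besselJ (ν + 1) x) *
      (ν / x * besselJ ν x - besselJ (ν + 1) x) < 0 := by
  have hx0 := hν.trans hx
  have h := div_pos (sq_mul_deriv_add_pos hν hx) hx0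
  rw [← neg_pos]
  refine h.trans_eq ?_
  field_simp
  ring

theorem exists_mul_deriv_besselJ_zero {ν : ℝ} (hν : 0 < ν) (M : ℝ) :
    ∃ x, M < x ∧ ν * besselJ ν x - x * besselJ (ν + 1) x = 0 := by
  obtain ⟨x, hx, h⟩ := exists_besselJ_zero hν (max M ν)
  obtain ⟨y, hy, h'⟩ := exists_besselJ_zero hν x
  obtain ⟨z, hz, -, h0⟩ := exists_zero_between
    (fun x hx => hasDerivAt_besselJ ν (hν.trans hx))
    (fun x hx => hasDerivAt_mul_deriv_besselJ hν (hν.trans hx))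
    (fun x hx => by
      have := wronskian_mul_deriv_besselJ_neg hν hx
      intro h
      linarith) ((le_max_right M ν).trans_lt hx) hy h h'
  exact ⟨z, ((le_max_left M ν).trans_lt hx).trans hz, h0⟩

theorem besselJ_interlacing_zero {ν : ℝ} (hν : 0 < ν) :
    ∃ a b : ℕ → ℝ, IsPosZeroSeq (fun x => ν * besselJ ν x - x * besselJ (ν + 1) x) a ∧
      IsPosZeroSeq (besselJ ν) b ∧ 0 < a 0 ∧ ∀ k : ℕ, a k < b k ∧ b k < a (k + 1) :=
  exists_interlacing hν (fun _ hx => hasDerivAt_mul_deriv_besselJ hν hx)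
    (fun _ hx => hasDerivAt_besselJ ν hx)
    (fun _ hx h => (besselJ_pos_and_mul_deriv_pos hν hx h).2)
    (fun _ hx h => (besselJ_pos_and_mul_deriv_pos hν hx h).1)
    (fun _ hx => wronskian_mul_deriv_besselJ_neg hν hx) (exists_mul_deriv_besselJ_zero hν)

theorem besselJ_interlacing_one {ν : ℝ} (hν : 0 < ν) :
    ∃ a b : ℕ → ℝ, IsPosZeroSeq (fun x => ν * besselJ ν x - x * besselJ (ν + 1) x) a ∧
      IsPosZeroSeq (besselJ (ν + 1)) b ∧ 0 < a 0 ∧ ∀ k : ℕ, a k < b k ∧ b k < a (k + 1) := by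
  have hd : ∀ x, 0 < x → HasDerivAt (fun x => x * besselJ (ν + 1) x)
      (x * besselJ ν x - ν * besselJ (ν + 1) x) x := fun x hx => by
    refine ((hasDerivAt_id x).fun_mul
      (hasDerivAt_besselJ_add_one (by linarith) hx)).congr_deriv ?_
    simp only [id]
    field_simp
    ring
  obtain ⟨a, b, ha, hb, hab⟩ := exists_interlacing hν
    (fun x hx => hasDerivAt_mul_deriv_besselJ hν hx) hd
    (fun x hx h => (besselJ_pos_and_mul_deriv_pos hν hx h).2)
    (fun x hx h => mul_pos hx (besselJ_add_one_pos hν hx h)) (fun x hx => by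
      have hx0 := hν.trans hx
      -- Replacing `J_ν` by `x J_(ν+1) = ν J_ν - x J_ν'` multiplies the Wronskian by `ν`.
      have h := mul_neg_of_pos_of_neg hν (wronskian_mul_deriv_besselJ_neg hν hx)
      refine lt_of_eq_of_lt ?_ h
      field_simp
      ring) (exists_mul_deriv_besselJ_zero hν)
  refine ⟨a, b, ha, ⟨hb.1, hb.2.trans ?_⟩, hab⟩
  ext x
  exact and_congr_right fun hx => mul_eq_zero_iff_left hx.ne'

theorem isPosZeroSeq_deriv_besselJ_iff {ν : ℝ} {a : ℕ → ℝ} :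
    IsPosZeroSeq (deriv (besselJ ν)) a ↔
      IsPosZeroSeq (fun x => ν * besselJ ν x - x * besselJ (ν + 1) x) a := by
  have h : {x : ℝ | 0 < x ∧ deriv (besselJ ν) x = 0} =
      {x : ℝ | 0 < x ∧ ν * besselJ ν x - x * besselJ (ν + 1) x = 0} := by
    ext x
    refine and_congr_right fun hx => ?_
    have : ν * besselJ ν x - x * besselJ (ν + 1) x = x * deriv (besselJ ν) x := by
      rw [(hasDerivAt_besselJ ν hx).deriv]
      field_simp
    simp [this, hx.ne']
  rw [IsPosZeroSeq, IsPosZeroSeq, h]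

theorem mainTheorem8 (ν : ℝ) (hν : 0 < ν) (m : ℕ) (hm : m = 0 ∨ m = 1) :
    ∃ j' j : ℕ → ℝ,
      IsPosZeroSeq (deriv (besselJ ν)) j' ∧
      IsPosZeroSeq (besselJ (ν + m)) j ∧
      0 < j' 0 ∧ ∀ k : ℕ, j' k < j k ∧ j k < j' (k + 1) := by
  simp only [isPosZeroSeq_deriv_besselJ_iff]
  rcases hm with rfl | rfl
  · simpa using besselJ_interlacing_zero hν
  · simpa using besselJ_interlacing_one hν
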